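/- **Setting.** Let $\mathcal{E}\subset\mathbb{R}^{d+1}$ ($d\ge 1$, points $(t,x)$) be an open space--time domain contained in $t_0<t<t_N$, $t_N=t_0+N\Delta t$, with a conforming finite mesh $\mathcal{T}_h$. Each $\mathcal{K}\in\mathcal{T}_h$ lies in one slab $t_n<t<t_{n+1}$, with bottom on $t=t_n$ and top on $t=t_{n+1}$, and $\mathcal{K}=\phi_{\mathcal K}(F_{\mathcal K}((-1,1)^{d+1}))$, where $F_{\mathcal K}$ is affine with linear part $\mathrm{diag}(\Delta t/2,h_1/2,\dots,h_d/2)$ and $\phi_{\mathcal K}$ is a $C^1$ diffeomorphism up to the boundary of the brick. Let $h_K=\frac12(\sum_i h_i^2)^{1/2}$, let $\mathcal{Q}$ be $\partial\mathcal{K}$ without its bottom and top, and $n=(n_t,\bar n)$ the outward unit normal on $\partial\mathcal K$. Let $\partial\mathcal{E}_D$ be a measurable part of $\partial\mathcal{E}\cap\{t_0<t<t_N\}$ and $\partial\mathcal{E}_N=\partial\mathcal{E}\setminus\partial\mathcal{E}_D$. Let $\nu>0$ be constant and $\beta=(1,\bar\beta)$ with $\bar\beta\in L^\infty(\mathcal{E})$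 and weak divergence $\nabla\cdot\beta=\overline\nabla\cdot\bar\beta\in L^\infty(\mathcal{E})$; $\beta\cdot n\in L^\infty(\partial\mathcal K)$ is the normal trace from $\mathcal{K}$ (defined by Green's formula), and $\beta_n=|\beta\cdot n|$. $\overline\nabla$ is the spatial gradient, $\overline\nabla_h,\nabla_h$ are elementwise gradients, and $\|\cdot\|_D$ is the $L^2(D)$ norm. $V_h$ is the set of $v_h\in L^2(\mathcal{E})$ with $v_h|_{\mathcal K}\circ\phi_{\mathcal K}\circ F_{\mathcal K}\in Q_{(p_t,p_s)}$ for all $\mathcal K$ (tensor-product polynomials of degree $p_t$ in time and $p_s$ in each space variable), and $M_h$ the set of $\mu_h$ in $L^2$ of the union of the facets which are likewise in $Q_{(p_t,p_s)}$ on every facet and vanish on $\partial\mathcal{E}_D$. With a penalty parameter $\alpha$, put $a_h=a_h^a+a_h^d$, $$a_h^a((u,\lambda),(v,\mu))=-\sum_{\mathcal K}\int_{\mathcal K}\beta u\cdot\nabla_h v\,dx+\int_{\partial\mathcal{E}_N}\tfrac12(\beta\cdot n+|\beta\cdot n|)\lambda\mu\,ds+\sum_{\mathcal K}\int_{\partial\mathcal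 K}\tfrac12\big(\beta\cdot n(u+\lambda)+|\beta\cdot n|(u-\lambda)\big)(v-\mu)\,ds,$$ $$a_h^d((u,\lambda),(v,\mu))=\sum_{\mathcal K}\int_{\mathcal K}\nu\overline\nabla_h u\cdot\overline\nabla_h v\,dx+\sum_{\mathcal K}\int_{\mathcal Q}\frac{\nu\alpha}{h_K}(u-\lambda)(v-\mu)\,ds-\sum_{\mathcal K}\int_{\mathcal Q}\big[\nu(u-\lambda)\overline\nabla_h v\cdot\bar n+\nu\overline\nabla_h u\cdot\bar n(v-\mu)\big]ds,$$ $$|||(v,\mu)|||_v^2=\|v\|_{\mathcal E}^2+\|\beta_n^{1/2}\mu\|_{\partial\mathcal{E}_N}^2+\sum_{\mathcal K}\|\beta_n^{1/2}(v-\mu)\|_{\partial\mathcal K}^2+\sum_{\mathcal K}\nu\|\overline\nabla_h v\|_{\mathcal K}^2+\sum_{\mathcal K}\frac{\nu}{h_K}\|v-\mu\|_{\mathcal Q}^2 .$$ **Constants.** Let $c_{T,\mathcal Q}>0$ be a constant of the local trace inequality $\|w\|_{\mathcal Q}\le c_{T,\mathcal Q}h_K^{-1/2}\|w\|_{\mathcal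 K}$, valid for $w=v_h$ and for $w=\overline\nabla_h v_h$, for all $v_h\in V_h$ and all $\mathcal K\in\mathcal T_h$. Let $c_p>0$ be a constant of the discrete Poincaré inequality $\|v_h\|_{\mathcal E}^2\le c_p^2\big(\sum_{\mathcal K}\|\overline\nabla_h v_h\|_{\mathcal K}^2+\sum_{\mathcal K}h_K^{-1}\|v_h-\mu_h\|_{\mathcal Q}^2\big)$ for all $(v_h,\mu_h)\in V_h\times M_h$. **Lemma (Stability).** Suppose $\alpha>c_{T,\mathcal Q}^2$, put $c_\alpha=(\alpha-c_{T,\mathcal Q}^2)/(1+\alpha)$, and suppose that for some constant $\beta_0$ $$\frac{c_\alpha\nu}{c_p^2}+\operatorname*{ess\,inf}_{\mathcal E}\overline\nabla\cdot\bar\beta\ \ge\ \beta_0>0 .$$ Then, with $c_c=\min(\beta_0,c_\alpha)/2>0$, which depends only on $\alpha$, $c_{T,\mathcal Q}$ and $\beta_0$ and not otherwise on the mesh (in particular not on $h_K$ and $\Delta t$), $$a_h((v_h,\mu_h),(v_h,\mu_h))\ \ge\ c_c\,|||(v_h,\mu_h)|||_v^2\qquad\text{for all }(v_h,\mu_h)\in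 V_h\times M_h .$$ -/

import Mathlib

open MeasureTheory Set
open scoped ContDiff ENNReal

noncomputable section

namespace STHDG

/-- Space-time `ℝ^{d+1}` with its Euclidean structure; coordinate `0` is time and the coordinates
`Fin.succ i`, `i : Fin d`, are the spatial ones. -/
abbrev X (d : ℕ) : Type := EuclideanSpace ℝ (Fin (d + 1))

/-- The closed master element `[-1,1]^{d+1}`. -/
def refCube (d : ℕ) : Set (X d) := {y | ∀ i, |y i| ≤ 1}

/-- The open master element `(-1,1)^{d+1}`. -/
def refOpenCube (d : ℕ) : Set (X d) := {y | ∀ i, |y i| < 1}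

/-- The sign attached to one of the two faces orthogonal to a coordinate direction. -/
def sgn (s : Bool) : ℝ := if s then 1 else -1

/-- The relatively open face `{y_i = ± 1}` of the master element. -/
def refFace (d : ℕ) (i : Fin (d + 1)) (s : Bool) : Set (X d) :=
  {y | y i = sgn s ∧ ∀ j, j ≠ i → |y j| < 1}

/-- The outward normal direction of the master element at a boundary point: on the relatively
open face `{y_i = ± 1}` it is `± e_i`. -/
def refNormal {d : ℕ} (y : X d) : X d :=
  WithLp.toLp 2 (fun i => if |y i| = 1 then y i else 0)

/-- A space-time element `K = φ (F (master element))`: `F` is the affine map with linear part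
`diag(Δt/2, h_1/2, …, h_d/2)` and translation `b`, and `φ` is a `C¹` diffeomorphism up to the
boundary of the brick `F (master element)`. (A `C¹` map on a neighbourhood of the closed brick is,
after multiplication with a cut-off function, the restriction of a `C¹` map on all of space-time.)
-/
structure Element (d : ℕ) (Δt : ℝ) where
  /-- the edge lengths `h_1, …, h_d` -/
  edge : Fin d → ℝ
  edge_pos : ∀ i, 0 < edge i
  b : X d
  φ : X d → X d
  φ_smooth : ContDiff ℝ 1 φ

namespace Element

variable {d : ℕ} {Δt : ℝ}

/-- The affine map `F`. -/
def F (K : Element d Δt) (y : X d) : X d :=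
  WithLp.toLp 2 (fun i => (Fin.cons Δt K.edge : Fin (d + 1) → ℝ) i / 2 * y i + K.b i)

/-- The parametrization `φ ∘ F` of the element over the master element. -/
def Φ (K : Element d Δt) (y : X d) : X d := K.φ (K.F y)

/-- `φ` is a diffeomorphism of the closed brick onto its image: it is injective there and its
Jacobian is invertible. -/
def IsDiffeo (K : Element d Δt) : Prop :=
  InjOn K.φ (K.F '' refCube d) ∧
    ∀ x ∈ K.F '' refCube d, (fderiv ℝ K.φ x).IsInvertible

/-- The closed element. -/
def carrier (K : Element d Δt) : Set (X d) := K.Φ '' refCube d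

/-- The open element. -/
def openCell (K : Element d Δt) : Set (X d) := K.Φ '' refOpenCube d

/-- The boundary `∂K`. -/
def boundary (K : Element d Δt) : Set (X d) := K.Φ '' {y ∈ refCube d | ∃ i, |y i| = 1}

/-- The lateral boundary `Q = ∂K \ (K^n ∪ K^{n+1})`. -/
def lateral (K : Element d Δt) : Set (X d) :=
  K.Φ '' {y ∈ refCube d | |y 0| < 1 ∧ ∃ i, |y i| = 1}

/-- The facets of the element, without their relative boundaries. -/
def facet (K : Element d Δt) (i : Fin (d + 1)) (s : Bool) : Set (X d) := K.Φ '' refFace d i s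

/-- `h_K`, the radius of the `d`-dimensional circumsphere of the brick `h_1 × ⋯ × h_d`. -/
def hK (K : Element d Δt) : ℝ := Real.sqrt (∑ i, K.edge i ^ 2) / 2

/-- The outward unit space-time normal `n = (n_t, n̄)` on `∂K`. It is `J^{-T} N / |J^{-T} N|`, where
`N` is the outward normal of the master element at the preimage of the point and `J` is the Jacobian
of the parametrization there. -/
def normal (K : Element d Δt) (x : X d) : X d :=
  let y := Function.invFunOn K.Φ (refCube d) x
  let w := ContinuousLinearMap.adjoint (ContinuousLinearMap.inverse (fderiv ℝ K.Φ y)) (refNormal y)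
  ‖w‖⁻¹ • w

/-- The spatial derivative `∂_{x_i} v` on the closed element; at boundary points this is the
one-sided derivative, i.e. the trace of the derivative in the interior. -/
def dx (K : Element d Δt) (v : X d → ℝ) (i : Fin d) (x : X d) : ℝ :=
  fderivWithin ℝ v K.carrier x (EuclideanSpace.single i.succ 1)

/-- `∇̄v · n̄` on the boundary of the element. -/
def dn (K : Element d Δt) (v : X d → ℝ) (x : X d) : ℝ := ∑ i, K.dx v i x * K.normal x i.succ

/-- `|∇̄v|²`. -/
def gradSq (K : Element d Δt) (v : X d → ℝ) (x : X d) : ℝ := ∑ i, K.dx v i x ^ 2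

end Element

/-- A space-time mesh of a space-time domain `E` over the time levels `t_n = t0 + n Δt`,
`0 ≤ n ≤ N`. Every element lies in one slab `t_n < t < t_{n+1}`, with its bottom on `t = t_n` and its
top on `t = t_{n+1}`. -/
structure Mesh (d : ℕ) where
  t0 : ℝ
  Δt : ℝ
  Δt_pos : 0 < Δt
  N : ℕ
  /-- the space-time domain `{(t,x) : x ∈ Ω(t), t_0 < t < t_N}` -/
  E : Set (X d)
  E_open : IsOpen E
  E_time : ∀ x ∈ E, t0 < x 0 ∧ x 0 < t0 + N * Δt
  /-- the number of elements -/
  m : ℕ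
  elt : Fin m → Element d Δt
  elt_diffeo : ∀ k, (elt k).IsDiffeo
  slab : Fin m → Fin N
  elt_time : ∀ k, ∀ x ∈ (elt k).openCell,
    t0 + (slab k : ℕ) * Δt < x 0 ∧ x 0 < t0 + ((slab k : ℕ) + 1) * Δt
  elt_bottom : ∀ k, ∀ x ∈ (elt k).facet 0 false, x 0 = t0 + (slab k : ℕ) * Δt
  elt_top : ∀ k, ∀ x ∈ (elt k).facet 0 true, x 0 = t0 + ((slab k : ℕ) + 1) * Δt
  cell_subset : ∀ k, (elt k).openCell ⊆ E
  cover : closure E = ⋃ k, (elt k).carrier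
  disjoint : ∀ k l, k ≠ l → Disjoint (elt k).openCell (elt l).openCell
  /-- every facet is a boundary facet or an interior facet shared with another element -/
  conforming : ∀ k i s, (elt k).facet i s ⊆ frontier E ∨
    ((elt k).facet i s ⊆ E ∧ ∃ l, l ≠ k ∧ ∃ j r, (elt l).facet j r = (elt k).facet i s)

/-- The tensor-product polynomials `Q_{(p_t,p_s)}`: degree at most `p_t` in time and at most `p_s` in
every spatial variable. -/
def IsQ {d : ℕ} (pt ps : ℕ) (q : MvPolynomial (Fin (d + 1)) ℝ) : Prop :=
  q.degreeOf 0 ≤ pt ∧ ∀ i : Fin d, q.degreeOf i.succ ≤ ps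

namespace Mesh

variable {d : ℕ}

/-- The lateral space-time boundary of the domain. -/
def lateralBoundary (M : Mesh d) : Set (X d) :=
  {x ∈ frontier M.E | M.t0 < x 0 ∧ x 0 < M.t0 + M.N * M.Δt}

/-- The Neumann (mixed) boundary: the complement of the Dirichlet boundary `D` in `∂E`. It contains
the initial and the final surface. -/
def neumann (M : Mesh d) (D : Set (X d)) : Set (X d) := frontier M.E \ D

/-- The space `V_h`. A broken function is the family `v k` of its restrictions to the closed elements
(traces from inside included); `v k` matters on the closed element number `k` only. -/
def IsVh (M : Mesh d) (pt ps : ℕ) (v : Fin M.m → X d → ℝ) : Prop :=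
  ∀ k, ∃ q : MvPolynomial (Fin (d + 1)) ℝ, IsQ pt ps q ∧
    ∀ y ∈ refCube d, v k ((M.elt k).Φ y) = MvPolynomial.eval (fun i => y i) q

/-- The space `M_h`: (single-valued) functions on the union of the facets which are tensor-product
polynomials on each facet and vanish on the Dirichlet boundary `D`. -/
def IsMh (M : Mesh d) (D : Set (X d)) (pt ps : ℕ) (μ : X d → ℝ) : Prop :=
  (∀ k i s, ∃ q : MvPolynomial (Fin (d + 1)) ℝ, IsQ pt ps q ∧
    ∀ y ∈ refFace d i s, μ ((M.elt k).Φ y) = MvPolynomial.eval (fun j => y j) q) ∧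
  ∀ᵐ x ∂(μHE[d].restrict D), μ x = 0

/-- The space-time velocity `β = (1, β̄)`. -/
def beta (βs : X d → EuclideanSpace ℝ (Fin d)) (x : X d) : X d :=
  WithLp.toLp 2 (Fin.cons 1 (fun i => βs x i))

/-- `δ` is the weak spatial divergence of `β̄` on `E`; since `β = (1, β̄)`, this is also the weak
space-time divergence of `β`. -/
def IsWeakDiv (M : Mesh d) (βs : X d → EuclideanSpace ℝ (Fin d)) (δ : X d → ℝ) : Prop :=
  ∀ ψ : X d → ℝ, ContDiff ℝ ∞ ψ → HasCompactSupport ψ → tsupport ψ ⊆ M.E →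
    ∫ x in M.E, ∑ i, βs x i * fderiv ℝ ψ x (EuclideanSpace.single i.succ 1)
      = -∫ x in M.E, δ x * ψ x

/-- `bn k` is the (outward) normal trace `β · n` on the boundary of the element number `k`, for a
bounded field `β = (1, β̄)` with bounded divergence `δ`: the function in `L^∞(∂K)` with
`∫_K (β · ∇ψ + ψ ∇ · β) dx = ∫_{∂K} (β · n) ψ ds` for all `ψ` in `C¹` of the closed element. -/
def IsNormalTrace (M : Mesh d) (βs : X d → EuclideanSpace ℝ (Fin d)) (δ : X d → ℝ)
    (bn : Fin M.m → X d → ℝ) : Prop :=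
  ∀ k, MemLp (bn k) ∞ (μHE[d].restrict (M.elt k).boundary) ∧
    ∀ ψ : X d → ℝ, ContDiffOn ℝ 1 ψ (M.elt k).carrier →
      ∫ x in (M.elt k).carrier,
          (fderivWithin ℝ ψ (M.elt k).carrier x (beta βs x) + δ x * ψ x)
        = ∫ x in (M.elt k).boundary, bn k x * ψ x ∂μHE[d]

/-- The advective form `a_h^a((u,l),(v,μ))`. The integral over the Neumann boundary is the sum of the
integrals over the parts of it that belong to the individual elements. -/
def aAdv (M : Mesh d) (D : Set (X d)) (βs : X d → EuclideanSpace ℝ (Fin d))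
    (bn : Fin M.m → X d → ℝ)
    (u : Fin M.m → X d → ℝ) (l : X d → ℝ) (v : Fin M.m → X d → ℝ) (μ : X d → ℝ) : ℝ :=
  -(∑ k, ∫ x in (M.elt k).carrier, u k x * fderivWithin ℝ (v k) (M.elt k).carrier x (beta βs x))
  + (∑ k, ∫ x in (M.elt k).boundary ∩ M.neumann D,
      1 / 2 * (bn k x + |bn k x|) * l x * μ x ∂μHE[d])
  + (∑ k, ∫ x in (M.elt k).boundary,
      1 / 2 * (bn k x * (u k x + l x) + |bn k x| * (u k x - l x)) * (v k x - μ x) ∂μHE[d])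

/-- The diffusive form `a_h^d((u,l),(v,μ))`. -/
def aDiff (M : Mesh d) (ν α : ℝ)
    (u : Fin M.m → X d → ℝ) (l : X d → ℝ) (v : Fin M.m → X d → ℝ) (μ : X d → ℝ) : ℝ :=
  (∑ k, ∫ x in (M.elt k).carrier, ν * ∑ i, (M.elt k).dx (u k) i x * (M.elt k).dx (v k) i x)
  + (∑ k, ∫ x in (M.elt k).lateral,
      ν * α / (M.elt k).hK * (u k x - l x) * (v k x - μ x) ∂μHE[d])
  - (∑ k, ∫ x in (M.elt k).lateral,
      (ν * (u k x - l x) * (M.elt k).dn (v k) x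
        + ν * (M.elt k).dn (u k) x * (v k x - μ x)) ∂μHE[d])

/-- The bilinear form `a_h = a_h^a + a_h^d`. -/
def aForm (M : Mesh d) (D : Set (X d)) (βs : X d → EuclideanSpace ℝ (Fin d))
    (bn : Fin M.m → X d → ℝ) (ν α : ℝ)
    (u : Fin M.m → X d → ℝ) (l : X d → ℝ) (v : Fin M.m → X d → ℝ) (μ : X d → ℝ) : ℝ :=
  M.aAdv D βs bn u l v μ + M.aDiff ν α u l v μ

/-- The square of the stability norm `|||(v,μ)|||_v`. -/
def normSq (M : Mesh d) (D : Set (X d)) (bn : Fin M.m → X d → ℝ) (ν : ℝ)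
    (v : Fin M.m → X d → ℝ) (μ : X d → ℝ) : ℝ :=
  (∑ k, ∫ x in (M.elt k).carrier, v k x ^ 2)
  + (∑ k, ∫ x in (M.elt k).boundary ∩ M.neumann D, |bn k x| * μ x ^ 2 ∂μHE[d])
  + (∑ k, ∫ x in (M.elt k).boundary, |bn k x| * (v k x - μ x) ^ 2 ∂μHE[d])
  + (∑ k, ν * ∫ x in (M.elt k).carrier, (M.elt k).gradSq (v k) x)
  + (∑ k, ν / (M.elt k).hK * ∫ x in (M.elt k).lateral, (v k x - μ x) ^ 2 ∂μHE[d])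

/-- `c` is a constant of the local trace inequality `‖w‖_Q ≤ c h_K^{-1/2} ‖w‖_K` (written for the
squares of the norms), for `w = v_h` and for `w = ∇̄_h v_h`, where `v_h` ranges over `V_h`. -/
def IsTraceConst (M : Mesh d) (pt ps : ℕ) (c : ℝ) : Prop :=
  ∀ v, M.IsVh pt ps v → ∀ k,
    (∫ x in (M.elt k).lateral, v k x ^ 2 ∂μHE[d]
      ≤ c ^ 2 / (M.elt k).hK * ∫ x in (M.elt k).carrier, v k x ^ 2) ∧
    (∫ x in (M.elt k).lateral, (M.elt k).gradSq (v k) x ∂μHE[d]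
      ≤ c ^ 2 / (M.elt k).hK * ∫ x in (M.elt k).carrier, (M.elt k).gradSq (v k) x)

/-- `c` is a constant of the discrete Poincaré inequality on `V_h × M_h`. -/
def IsPoincareConst (M : Mesh d) (D : Set (X d)) (pt ps : ℕ) (c : ℝ) : Prop :=
  ∀ v μ, M.IsVh pt ps v → M.IsMh D pt ps μ →
    ∑ k, ∫ x in (M.elt k).carrier, v k x ^ 2
      ≤ c ^ 2 * ((∑ k, ∫ x in (M.elt k).carrier, (M.elt k).gradSq (v k) x)
        + ∑ k, 1 / (M.elt k).hK * ∫ x in (M.elt k).lateral, (v k x - μ x) ^ 2 ∂μHE[d])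

end Mesh

end STHDG

end

/-! Both forms are evaluated on the diagonal and bounded separately.

Advection. Green's formula for `v²` on each element turns the volume term into half of `∫ δ v²`
minus half of the boundary integral of `bn v²`. In the facet term `(v + μ)(v - μ) = v² - μ²`, so the
`v²` contributions cancel and the signed integrals of `bn μ²` remain. Since `μ` is single-valued and
the normal traces seen from the elements sum to zero inside `E` (`traceSum_ae_eq_zero`), and since
`μ` vanishes on `D`, only the Neumann part survives; it cancels the signed half of the Neumann term.
Hence the identity `aAdv_self`: half the sum of `∫ δ v²` and the two integrals weighted by `|bn|`.

Diffusion. On one element the consistency terms are controlled by Young's inequality and the trace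
inequality for the gradient. With `c_α = (α - cT²)/(1 + α)` this leaves `ν c_α` times gradients plus
scaled jumps (`diffusion_coercive`).

Conclusion. Half of the diffusive bound is kept for the gradients and jumps of the norm. The other
half becomes a multiple of `‖v‖²` by the discrete Poincaré inequality and compensates a possibly
negative divergence, which is what the condition on `β₀` expresses.

The remaining work justifies the integrals: closed elements are `C¹` images of a cube, their
boundaries have zero volume and finite `d`-dimensional measure, and all integrands are essentially
bounded. -/

namespace STHDG

/-! ### Geometry and measure of the master cube and its boundary. -/

section Cube

variable {d : ℕ}

theorem refCube_eq_preimage (d : ℕ) :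
    refCube d = (EuclideanSpace.equiv (Fin (d + 1)) ℝ) ⁻¹' Icc (-1) 1 := by
  ext y
  simp [refCube, abs_le, Pi.le_def, forall_and]

theorem convex_refCube (d : ℕ) : Convex ℝ (refCube d) := by
  rw [refCube_eq_preimage]
  exact (convex_Icc _ _).linear_preimage (EuclideanSpace.equiv (Fin (d + 1)) ℝ).toLinearMap

theorem isCompact_refCube (d : ℕ) : IsCompact (refCube d) := by
  rw [refCube_eq_preimage]
  exact (EuclideanSpace.equiv (Fin (d + 1)) ℝ).toHomeomorph.isCompact_preimage.2 isCompact_Icc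

theorem isOpen_refOpenCube (d : ℕ) : IsOpen (refOpenCube d) := by
  have : refOpenCube d = ⋂ i, {y : X d | |y i| < 1} := by ext; simp [refOpenCube]
  rw [this]
  exact isOpen_iInter_of_finite fun i => isOpen_lt (by fun_prop) continuous_const

theorem refOpenCube_subset (d : ℕ) : refOpenCube d ⊆ refCube d := fun _ h i => (h i).le

theorem uniqueDiffOn_refCube (d : ℕ) : UniqueDiffOn ℝ (refCube d) :=
  uniqueDiffOn_convex (convex_refCube d)
    ⟨0, interior_maximal (refOpenCube_subset d) (isOpen_refOpenCube d) (by simp [refOpenCube])⟩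

theorem measurableSet_refFace (i : Fin (d + 1)) (s : Bool) : MeasurableSet (refFace d i s) := by
  have : refFace d i s = {y : X d | y i = sgn s} ∩ ⋂ j, ⋂ _ : j ≠ i, {y : X d | |y j| < 1} := by
    ext; simp [refFace]
  rw [this]
  refine ((isClosed_eq (by fun_prop) continuous_const).measurableSet).inter
    (MeasurableSet.iInter fun j => MeasurableSet.iInter fun _ =>
      (isOpen_lt (by fun_prop) continuous_const).measurableSet)

/-- The boundary of the master element. -/
def refBoundary (d : ℕ) : Set (X d) := {y ∈ refCube d | ∃ i, |y i| = 1}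

theorem refBoundary_subset : refBoundary d ⊆ refCube d := fun _ h => h.1

theorem isCompact_refBoundary (d : ℕ) : IsCompact (refBoundary d) := by
  have : refBoundary d = refCube d ∩ ⋃ i, {y : X d | |y i| = 1} := by
    ext; simp [refBoundary]
  rw [this]
  exact (isCompact_refCube d).inter_right
    (isClosed_iUnion_of_finite fun i => isClosed_eq (by fun_prop) continuous_const)

theorem refCube_eq_union : refCube d = refOpenCube d ∪ refBoundary d := by
  ext y
  constructor
  · intro h
    by_cases hy : ∃ i, |y i| = 1
    · exact Or.inr ⟨h, hy⟩
    · push Not at hy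
      exact Or.inl fun i => lt_of_le_of_ne (h i) (hy i)
  · rintro (h | h)
    exacts [refOpenCube_subset d h, h.1]

theorem refFace_subset (i : Fin (d + 1)) (s : Bool) : refFace d i s ⊆ refBoundary d := by
  intro y hy
  have h1 : |y i| = 1 := by rw [hy.1]; cases s <;> simp [sgn]
  refine ⟨fun j => ?_, i, h1⟩
  by_cases hj : j = i
  · rw [hj, h1]
  · exact (hy.2 j hj).le

theorem eq_sgn_of_abs_eq_one {t : ℝ} (h : |t| = 1) : ∃ s, t = sgn s := by
  rcases (abs_eq zero_le_one).1 h with h | h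
  · exact ⟨true, by simp [sgn, h]⟩
  · exact ⟨false, by simp [sgn, h]⟩

/-- Embedding of a coordinate hyperplane. -/
def hyperplaneEmb (i : Fin (d + 1)) (a : ℝ) (z : Fin d → ℝ) : X d :=
  WithLp.toLp 2 (i.insertNth a z)

theorem contDiff_insertNth {n : ℕ} (i : Fin (n + 1)) (a : ℝ) :
    ContDiff ℝ 1 fun z : Fin n → ℝ => (i.insertNth a z : Fin (n + 1) → ℝ) := by
  rw [contDiff_pi]
  intro j
  rcases Fin.eq_self_or_eq_succAbove i j with rfl | ⟨k, rfl⟩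
  · simpa using contDiff_const
  · simpa using contDiff_apply ℝ ℝ k

theorem contDiff_hyperplaneEmb (i : Fin (d + 1)) (a : ℝ) : ContDiff ℝ 1 (hyperplaneEmb i a) :=
  (PiLp.contDiff_toLp (𝕜 := ℝ) (p := 2)).comp (contDiff_insertNth i a)

theorem mem_image_hyperplaneEmb {y : X d} (hy : y ∈ refCube d) (i : Fin (d + 1)) :
    y ∈ hyperplaneEmb i (y i) '' Icc (-1) 1 := by
  refine ⟨fun j => y (i.succAbove j), ?_, ?_⟩
  · simp only [mem_Icc, Pi.le_def]
    exact ⟨fun j => (abs_le.1 (hy _)).1, fun j => (abs_le.1 (hy _)).2⟩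
  · ext j
    rcases Fin.eq_self_or_eq_succAbove i j with rfl | ⟨k, rfl⟩ <;> simp [hyperplaneEmb]

theorem refBoundary_subset_iUnion :
    refBoundary d ⊆ ⋃ p : Fin (d + 1) × Bool, hyperplaneEmb p.1 (sgn p.2) '' Icc (-1) 1 := by
  rintro y ⟨hy, i, hi⟩
  obtain ⟨s, hs⟩ := eq_sgn_of_abs_eq_one hi
  refine mem_iUnion.2 ⟨(i, s), ?_⟩
  rw [← hs]
  exact mem_image_hyperplaneEmb hy i

/-- The part of the boundary of the master element on which two coordinates are `± 1`. -/
def refEdges (d : ℕ) : Set (X d) :=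
  {y ∈ refCube d | ∃ i j, i ≠ j ∧ |y i| = 1 ∧ |y j| = 1}

theorem refBoundary_subset_union :
    refBoundary d ⊆ (⋃ p : Fin (d + 1) × Bool, refFace d p.1 p.2) ∪ refEdges d := by
  rintro y ⟨hy, i, hi⟩
  by_cases h : ∃ j, j ≠ i ∧ |y j| = 1
  · obtain ⟨j, hj, h1⟩ := h
    exact Or.inr ⟨hy, i, j, hj.symm, hi, h1⟩
  · push Not at h
    obtain ⟨s, hs⟩ := eq_sgn_of_abs_eq_one hi
    exact Or.inl (mem_iUnion.2 ⟨(i, s), hs, fun j hj => lt_of_le_of_ne (hy j) (h j hj)⟩)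

/-- Fixing two coordinates leaves `d - 1` parameters, and a `C¹` image of such a set has Hausdorff
dimension at most `d - 1`. Consequently data prescribed on the relatively open facets determine a
function almost everywhere on the boundary. -/
theorem hausdorffMeasure_image_refEdges {f : X d → X d} (hf : ContDiff ℝ 1 f) :
    μHE[d] (f '' refEdges d) = 0 := by
  rcases d with _ | e
  · have : refEdges 0 = ∅ := by
      ext y
      simp only [refEdges, mem_ofPred_eq, mem_empty_iff_false, iff_false]
      rintro ⟨-, i, j, hij, -⟩
      exact hij (Subsingleton.elim (α := Fin 1) i j)
    simp [this]
  have key : ∀ (i : Fin (e + 2)) (j : Fin (e + 1)) (a b : ℝ),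
      μHE[e + 1] (range fun z : Fin e → ℝ =>
        f (hyperplaneEmb i a (j.insertNth b z : Fin (e + 1) → ℝ))) = 0 := by
    intro i j a b
    have hc : ContDiff ℝ 1 fun z : Fin e → ℝ =>
        f (hyperplaneEmb i a (j.insertNth b z : Fin (e + 1) → ℝ)) :=
      hf.comp ((contDiff_hyperplaneEmb i a).comp (contDiff_insertNth j b))
    have hd := hc.dimH_range_le
    have h0 : μH[((e + 1 : ℕ) : NNReal)] (range fun z : Fin e → ℝ =>
        f (hyperplaneEmb i a (j.insertNth b z : Fin (e + 1) → ℝ))) = 0 := by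
      refine hausdorffMeasure_of_dimH_lt (hd.trans_lt ?_)
      simp only [Module.finrank_fintype_fun_eq_card, Fintype.card_fin]
      exact_mod_cast Nat.lt_succ_self e
    rw [Measure.euclideanHausdorffMeasure_def, Measure.smul_apply]
    have h1 : μH[((e + 1 : ℕ) : ℝ)] (range fun z : Fin e → ℝ =>
        f (hyperplaneEmb i a (j.insertNth b z : Fin (e + 1) → ℝ))) = 0 := by
      simpa using h0
    rw [h1, smul_zero]
  refine measure_mono_null (t := ⋃ p : (Fin (e + 2) × Fin (e + 1)) × (Bool × Bool),
      range fun z : Fin e → ℝ =>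
        f (hyperplaneEmb p.1.1 (sgn p.2.1) (p.1.2.insertNth (sgn p.2.2) z : Fin (e + 1) → ℝ))) ?_
    (measure_iUnion_null fun p => key _ _ _ _)
  rintro _ ⟨y, ⟨hy, i, j, hij, hi, hj⟩, rfl⟩
  obtain ⟨s, hs⟩ := eq_sgn_of_abs_eq_one hi
  obtain ⟨r, hr⟩ := eq_sgn_of_abs_eq_one hj
  obtain ⟨k, rfl⟩ := Fin.exists_succAbove_eq hij.symm
  refine mem_iUnion.2 ⟨((i, k), (s, r)), fun l => y (i.succAbove (k.succAbove l)), ?_⟩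
  refine congrArg f ?_
  ext m
  rcases Fin.eq_self_or_eq_succAbove i m with rfl | ⟨m, rfl⟩
  · simp [hyperplaneEmb, hs]
  · rcases Fin.eq_self_or_eq_succAbove k m with rfl | ⟨m, rfl⟩ <;> simp [hyperplaneEmb, hr]

/-- Each face is a `C¹`, hence Lipschitz, image of the compact cube `[-1,1]^d`, on which
`d`-dimensional Hausdorff measure for the sup metric is Lebesgue measure. -/
theorem hausdorffMeasure_image_refBoundary_lt_top {f : X d → X d} (hf : ContDiff ℝ 1 f) :
    μHE[d] (f '' refBoundary d) < ⊤ := by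
  have key : ∀ (i : Fin (d + 1)) (a : ℝ),
      μHE[d] ((fun z => f (hyperplaneEmb i a z)) '' Icc (-1) 1) < ⊤ := by
    intro i a
    have hc : ContDiff ℝ 1 fun z => f (hyperplaneEmb i a z) :=
      hf.comp (contDiff_hyperplaneEmb i a)
    obtain ⟨K, hK⟩ := (hc.locallyLipschitz.locallyLipschitzOn
      (s := Icc (-1) 1)).exists_lipschitzOnWith_of_compact isCompact_Icc
    have h1 := hK.hausdorffMeasure_image_le (d := d) (by positivity)
    have h2 : (μH[d] : Measure (Fin d → ℝ)) = volume := by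
      simpa using hausdorffMeasure_pi_real (ι := Fin d)
    rw [Measure.euclideanHausdorffMeasure_def, Measure.smul_apply]
    refine ENNReal.mul_lt_top ENNReal.coe_lt_top (h1.trans_lt ?_)
    rw [h2]
    refine ENNReal.mul_lt_top ?_ isCompact_Icc.measure_lt_top
    simp
  refine (measure_mono (image_mono refBoundary_subset_iUnion)).trans_lt ?_
  rw [image_iUnion]
  refine (measure_iUnion_fintype_le _ _).trans_lt (ENNReal.sum_lt_top.2 fun p _ => ?_)
  rw [image_image]
  exact key _ _

theorem volume_refBoundary (d : ℕ) : volume (refBoundary d) = 0 := by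
  refine measure_mono_null refBoundary_subset_iUnion (measure_iUnion_null fun p => ?_)
  have h := (contDiff_hyperplaneEmb p.1 (sgn p.2)).dimH_range_le
  have h0 : μH[((d + 1 : ℕ) : NNReal)] (range (hyperplaneEmb p.1 (sgn p.2))) = 0 := by
    refine hausdorffMeasure_of_dimH_lt (h.trans_lt ?_)
    simp only [Module.finrank_fintype_fun_eq_card, Fintype.card_fin]
    exact_mod_cast Nat.lt_succ_self d
  have h1 : μHE[d + 1] (range (hyperplaneEmb p.1 (sgn p.2))) = 0 := by
    rw [Measure.euclideanHausdorffMeasure_def, Measure.smul_apply]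
    have : μH[((d + 1 : ℕ) : ℝ)] (range (hyperplaneEmb p.1 (sgn p.2))) = 0 := by simpa using h0
    rw [this, smul_zero]
  rw [EuclideanSpace.euclideanHausdorffMeasure_eq_volume] at h1
  exact measure_mono_null (image_subset_range _ _) h1

end Cube

/-! ### The element parametrization, its inverse, and closed elements. -/

namespace Element

variable {d : ℕ} {Δt : ℝ} (K : Element d Δt)

theorem contDiff_F : ContDiff ℝ 1 K.F := by
  refine (PiLp.contDiff_toLp (𝕜 := ℝ) (p := 2)).comp (contDiff_pi.2 fun i => ?_)
  fun_prop

theorem contDiff_Φ : ContDiff ℝ 1 K.Φ := K.φ_smooth.comp K.contDiff_F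

theorem F_eq (hΔt : 0 < Δt) : ∃ L : X d ≃L[ℝ] X d, ∀ y, K.F y = L y + K.b := by
  have hpos : ∀ i, (Fin.cons Δt K.edge : Fin (d + 1) → ℝ) i / 2 ≠ 0 := by
    intro i
    refine Fin.cases ?_ (fun j => ?_) i
    · simpa using hΔt.ne'
    · simpa using (K.edge_pos j).ne'
  let D : (Fin (d + 1) → ℝ) ≃L[ℝ] (Fin (d + 1) → ℝ) :=
    ContinuousLinearEquiv.piCongrRight fun i =>
      ContinuousLinearEquiv.unitsEquivAut ℝ (Units.mk0 _ (hpos i))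
  refine ⟨((EuclideanSpace.equiv _ ℝ).trans D).trans (EuclideanSpace.equiv _ ℝ).symm, fun y => ?_⟩
  ext i
  simp [F, D, mul_comm]

variable {K}

theorem injOn_Φ (hΔt : 0 < Δt) (hK : K.IsDiffeo) : InjOn K.Φ (refCube d) := by
  intro x hx y hy h
  obtain ⟨L, hL⟩ := K.F_eq hΔt
  have := hK.1 (mem_image_of_mem _ hx) (mem_image_of_mem _ hy) h
  rw [hL, hL] at this
  exact L.injective (add_right_cancel this)

theorem exists_hasFDerivAt_Φ (hΔt : 0 < Δt) (hK : K.IsDiffeo) {y : X d} (hy : y ∈ refCube d) :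
    ∃ L : X d ≃L[ℝ] X d, HasFDerivAt K.Φ (L : X d →L[ℝ] X d) y := by
  obtain ⟨L, hL⟩ := K.F_eq hΔt
  obtain ⟨L', hL'⟩ := hK.2 _ (mem_image_of_mem _ hy)
  have h1 : HasFDerivAt K.F (L : X d →L[ℝ] X d) y := by
    have : K.F = fun y => L y + K.b := funext hL
    rw [this]
    exact L.hasFDerivAt.add_const _
  have h2 : HasFDerivAt K.φ (L' : X d →L[ℝ] X d) (K.F y) := by
    rw [hL']
    exact (K.φ_smooth.differentiable (by norm_num) _).hasFDerivAt
  exact ⟨L.trans L', h2.comp y h1⟩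

/-- An invertible derivative carries the tangent directions of the convex cube to a spanning set.
This makes `fderivWithin` meaningful up to the boundary, where the one-sided gradients are used. -/
theorem uniqueDiffOn_carrier (hΔt : 0 < Δt) (hK : K.IsDiffeo) : UniqueDiffOn ℝ K.carrier := by
  rintro _ ⟨y, hy, rfl⟩
  obtain ⟨L, hL⟩ := exists_hasFDerivAt_Φ hΔt hK hy
  exact hL.hasFDerivWithinAt.uniqueDiffWithinAt (uniqueDiffOn_refCube d y hy) L.surjective.denseRange

variable (K) in
theorem isCompact_carrier : IsCompact K.carrier :=
  (isCompact_refCube d).image K.contDiff_Φ.continuous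

variable (K) in
theorem isCompact_boundary : IsCompact K.boundary :=
  (isCompact_refBoundary d).image K.contDiff_Φ.continuous

variable (K) in
theorem boundary_subset_carrier : K.boundary ⊆ K.carrier := image_mono refBoundary_subset

variable (K) in
theorem lateral_subset_boundary : K.lateral ⊆ K.boundary :=
  image_mono fun _ h => ⟨h.1, h.2.2⟩

variable (K) in
theorem carrier_eq_union : K.carrier = K.openCell ∪ K.boundary := by
  unfold carrier openCell
  rw [refCube_eq_union, image_union]
  rfl

variable (K) in
theorem volume_boundary : volume K.boundary = 0 :=
  addHaar_image_eq_zero_of_differentiableOn_of_addHaar_eq_zero volume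
    (K.contDiff_Φ.differentiable (by norm_num)).differentiableOn (volume_refBoundary d)

variable (K) in
theorem hausdorffMeasure_boundary_lt_top : μHE[d] K.boundary < ⊤ :=
  hausdorffMeasure_image_refBoundary_lt_top K.contDiff_Φ

variable (K) in
theorem boundary_subset_union :
    K.boundary ⊆ (⋃ p : Fin (d + 1) × Bool, K.facet p.1 p.2) ∪ K.Φ '' refEdges d := by
  refine (image_mono refBoundary_subset_union).trans ?_
  rw [image_union, image_iUnion]
  rfl

variable (K) in
theorem facet_subset_boundary (i : Fin (d + 1)) (s : Bool) : K.facet i s ⊆ K.boundary :=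
  image_mono (refFace_subset i s)

theorem measurableSet_facet (hΔt : 0 < Δt) (hK : K.IsDiffeo) (i : Fin (d + 1)) (s : Bool) :
    MeasurableSet (K.facet i s) :=
  (measurableSet_refFace i s).image_of_continuousOn_injOn K.contDiff_Φ.continuous.continuousOn
    ((injOn_Φ hΔt hK).mono ((refFace_subset i s).trans refBoundary_subset))

theorem measurableSet_openCell (hΔt : 0 < Δt) (hK : K.IsDiffeo) : MeasurableSet K.openCell :=
  (isOpen_refOpenCube d).measurableSet.image_of_continuousOn_injOn
    K.contDiff_Φ.continuous.continuousOn ((injOn_Φ hΔt hK).mono (refOpenCube_subset d))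

/-- The inverse of the parametrization. -/
noncomputable def chart (K : Element d Δt) : X d → X d := Function.invFunOn K.Φ (refCube d)

theorem chart_Φ (hΔt : 0 < Δt) (hK : K.IsDiffeo) {y : X d} (hy : y ∈ refCube d) :
    K.chart (K.Φ y) = y :=
  (injOn_Φ hΔt hK).leftInvOn_invFunOn hy

/-- A continuous injection of a compact set is a closed map onto its image. -/
theorem continuousOn_chart (hΔt : 0 < Δt) (hK : K.IsDiffeo) : ContinuousOn K.chart K.carrier := by
  rw [continuousOn_iff_isClosed]
  intro t ht
  refine ⟨K.Φ '' (refCube d ∩ t),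
    (((isCompact_refCube d).inter_right ht).image K.contDiff_Φ.continuous).isClosed, ?_⟩
  ext x
  constructor
  · rintro ⟨hx, y, hy, rfl⟩
    have := chart_Φ hΔt hK hy
    rw [mem_preimage, this] at hx
    exact ⟨⟨y, ⟨hy, hx⟩, rfl⟩, ⟨y, hy, rfl⟩⟩
  · rintro ⟨⟨y, ⟨hy, hyt⟩, rfl⟩, h⟩
    refine ⟨?_, h⟩
    rwa [mem_preimage, chart_Φ hΔt hK hy]

/-- Near each point the chart agrees with the local inverse from the inverse function theorem; its
continuity is what keeps its values in the domain of that local inverse. Discrete functions are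
thereby `C¹` on the closed element. -/
theorem contDiffOn_chart (hΔt : 0 < Δt) (hK : K.IsDiffeo) :
    ContDiffOn ℝ 1 K.chart K.carrier := by
  intro x hx
  have hxc := continuousOn_chart hΔt hK x hx
  obtain ⟨y, hy, rfl⟩ := hx
  obtain ⟨L, hL⟩ := exists_hasFDerivAt_Φ hΔt hK hy
  have hcd : ContDiffAt ℝ 1 K.Φ y := K.contDiff_Φ.contDiffAt
  let e := hcd.toOpenPartialHomeomorph K.Φ hL one_ne_zero
  have hys : y ∈ e.source := hcd.mem_toOpenPartialHomeomorph_source hL one_ne_zero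
  have he : ContDiffAt ℝ 1 e.symm (K.Φ y) := hcd.to_localInverse hL one_ne_zero
  refine he.contDiffWithinAt.congr_of_eventuallyEq ?_ ?_
  · have hnb : ∀ᶠ x in nhdsWithin (K.Φ y) K.carrier, K.chart x ∈ e.source := by
      refine hxc (e.open_source.mem_nhds ?_)
      rwa [chart_Φ hΔt hK hy]
    filter_upwards [hnb, self_mem_nhdsWithin] with x h1 h2
    obtain ⟨z, hz, rfl⟩ := h2
    rw [chart_Φ hΔt hK hz] at h1 ⊢
    exact (e.left_inv h1).symm
  · rw [chart_Φ hΔt hK hy]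
    exact (e.left_inv hys).symm

theorem hK_pos (hd : 0 < d) (K : Element d Δt) : 0 < K.hK := by
  refine half_pos (Real.sqrt_pos.2 (Finset.sum_pos (fun i _ => pow_pos (K.edge_pos i) 2) ?_))
  exact ⟨⟨0, hd⟩, Finset.mem_univ _⟩

end Element

end STHDG

/-! ### Essential boundedness, the source of all integrability. -/

namespace STHDG

theorem MemLp.mul_top {Ω : Type*} [MeasurableSpace Ω] {ρ : Measure Ω} {f g : Ω → ℝ}
    (hf : MemLp f ⊤ ρ) (hg : MemLp g ⊤ ρ) : MemLp (fun x => f x * g x) ⊤ ρ :=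
  MeasureTheory.MemLp.mul' hg hf

theorem MemLp.sq_top {Ω : Type*} [MeasurableSpace Ω] {ρ : Measure Ω} {f : Ω → ℝ}
    (hf : MemLp f ⊤ ρ) : MemLp (fun x => f x ^ 2) ⊤ ρ := by
  simpa only [sq] using MemLp.mul_top hf hf

theorem memLp_top_restrict_of_continuousOn {Ω F : Type*} [TopologicalSpace Ω] [T2Space Ω]
    [MeasurableSpace Ω] [BorelSpace Ω] [NormedAddCommGroup F] [SecondCountableTopology F]
    {ρ : Measure Ω} {f : Ω → F} {s : Set Ω} (hs : IsCompact s) (hf : ContinuousOn f s) :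
    MemLp f ⊤ (ρ.restrict s) := by
  obtain ⟨C, hC⟩ := hs.exists_bound_of_continuousOn hf
  exact memLp_top_of_bound (hf.aestronglyMeasurable hs.measurableSet) C
    (ae_restrict_of_forall_mem hs.measurableSet hC)

theorem ae_abs_le_of_memLp_top {Ω : Type*} [MeasurableSpace Ω] {ρ : Measure Ω} {f : Ω → ℝ}
    (hf : MemLp f ⊤ ρ) : ∃ C : ℝ, ∀ᵐ x ∂ρ, |f x| ≤ C := by
  refine ⟨(eLpNormEssSup f ρ).toReal, ?_⟩
  have hlt : eLpNormEssSup f ρ ≠ ⊤ := by simpa using hf.2.ne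
  filter_upwards [ae_le_eLpNormEssSup (f := f) (μ := ρ)] with x hx
  have := ENNReal.toReal_mono hlt hx
  simpa using this

theorem contDiff_eval_mvPolynomial {d : ℕ} (q : MvPolynomial (Fin (d + 1)) ℝ) :
    ContDiff ℝ 1 fun y : X d => MvPolynomial.eval (fun i => y i) q := by
  induction q using MvPolynomial.induction_on with
  | C a => simpa using contDiff_const
  | add p q hp hq => simpa using hp.add hq
  | mul_X p i hp =>
    simp only [map_mul, MvPolynomial.eval_X]
    exact hp.mul (by fun_prop)

theorem apply_beta {d : ℕ} (A : X d →L[ℝ] ℝ) (βs : X d → EuclideanSpace ℝ (Fin d)) (x : X d) :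
    A (Mesh.beta βs x) = A (EuclideanSpace.single 0 1)
      + ∑ i : Fin d, βs x i * A (EuclideanSpace.single i.succ 1) := by
  have : Mesh.beta βs x = EuclideanSpace.single 0 1
      + ∑ i : Fin d, βs x i • EuclideanSpace.single i.succ (1 : ℝ) := by
    ext j
    refine Fin.cases ?_ (fun k => ?_) j
    · simp [Mesh.beta, Finset.sum_apply]
    · simp [Mesh.beta, Finset.sum_apply, Pi.single_apply]
  rw [this, map_add, map_sum]
  simp

theorem memLp_coord {d n : ℕ} {ρ : Measure (X d)} {βs : X d → EuclideanSpace ℝ (Fin n)}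
    (h : MemLp βs ⊤ ρ) (i : Fin n) : MemLp (fun x => βs x i) ⊤ ρ :=
  (EuclideanSpace.proj (𝕜 := ℝ) i : EuclideanSpace ℝ (Fin n) →L[ℝ] ℝ).comp_memLp' h

theorem memLp_apply_beta {d : ℕ} {ρ : Measure (X d)} {A : X d → X d →L[ℝ] ℝ}
    {βs : X d → EuclideanSpace ℝ (Fin d)}
    (hA : ∀ w, MemLp (fun x => A x w) ⊤ ρ) (hβ : MemLp βs ⊤ ρ) :
    MemLp (fun x => A x (Mesh.beta βs x)) ⊤ ρ := by
  simp only [apply_beta]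
  exact (hA _).add (memLp_finsetSum _ fun i _ => MemLp.mul_top (memLp_coord hβ i) (hA _))

namespace Element

variable {d : ℕ} {Δt : ℝ} {K : Element d Δt}

theorem contDiffOn_of_comp_eq_eval (hΔt : 0 < Δt) (hK : K.IsDiffeo) {f : X d → ℝ}
    {q : MvPolynomial (Fin (d + 1)) ℝ}
    (hq : ∀ y ∈ refCube d, f (K.Φ y) = MvPolynomial.eval (fun i => y i) q) :
    ContDiffOn ℝ 1 f K.carrier := by
  refine ((contDiff_eval_mvPolynomial q).comp_contDiffOn (contDiffOn_chart hΔt hK)).congr ?_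
  rintro _ ⟨y, hy, rfl⟩
  rw [hq y hy, Function.comp_apply, chart_Φ hΔt hK hy]

theorem continuousOn_fderivWithin_apply (hΔt : 0 < Δt) (hK : K.IsDiffeo) {f : X d → ℝ}
    (hf : ContDiffOn ℝ 1 f K.carrier) (w : X d) :
    ContinuousOn (fun x => fderivWithin ℝ f K.carrier x w) K.carrier :=
  (hf.continuousOn_fderivWithin (uniqueDiffOn_carrier hΔt hK) le_rfl).clm_apply
    continuousOn_const

theorem continuousOn_gradSq (hΔt : 0 < Δt) (hK : K.IsDiffeo) {f : X d → ℝ}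
    (hf : ContDiffOn ℝ 1 f K.carrier) : ContinuousOn (K.gradSq f) K.carrier :=
  continuousOn_finsetSum _ fun _ _ => (continuousOn_fderivWithin_apply hΔt hK hf _).pow 2

theorem memLp_top_boundary {F : Type*} [NormedAddCommGroup F] [SecondCountableTopology F]
    {ρ : Measure (X d)} {f : X d → F} (hf : ContinuousOn f K.carrier) :
    MemLp f ⊤ (ρ.restrict K.boundary) :=
  memLp_top_restrict_of_continuousOn K.isCompact_boundary (hf.mono K.boundary_subset_carrier)

theorem memLp_top_carrier {F : Type*} [NormedAddCommGroup F] [SecondCountableTopology F]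
    {ρ : Measure (X d)} {f : X d → F} (hf : ContinuousOn f K.carrier) :
    MemLp f ⊤ (ρ.restrict K.carrier) :=
  memLp_top_restrict_of_continuousOn K.isCompact_carrier hf

instance isFiniteMeasure_boundary : IsFiniteMeasure (μHE[d].restrict K.boundary) :=
  ⟨by simpa using K.hausdorffMeasure_boundary_lt_top⟩

instance isFiniteMeasure_carrier : IsFiniteMeasure (volume.restrict K.carrier) :=
  ⟨by simpa using K.isCompact_carrier.measure_lt_top⟩

/-- A function that is polynomial on every facet is essentially bounded on the boundary. -/
theorem memLp_top_boundary_of_facets (hΔt : 0 < Δt) (hK : K.IsDiffeo) {μ : X d → ℝ}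
    (h : ∀ i s, ∃ q : MvPolynomial (Fin (d + 1)) ℝ, ∀ y ∈ refFace d i s,
      μ (K.Φ y) = MvPolynomial.eval (fun j => y j) q) :
    MemLp μ ⊤ (μHE[d].restrict K.boundary) := by
  have hfac : ∀ i s, MemLp μ ⊤ (μHE[d].restrict (K.facet i s)) := by
    intro i s
    obtain ⟨q, hq⟩ := h i s
    have hc : ContinuousOn (fun x => MvPolynomial.eval (fun j => K.chart x j) q) K.carrier :=
      (contDiff_eval_mvPolynomial q).continuous.comp_continuousOn (continuousOn_chart hΔt hK)
    have hm : MemLp (fun x => MvPolynomial.eval (fun j => K.chart x j) q) ⊤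
        (μHE[d].restrict (K.facet i s)) :=
      (memLp_top_boundary hc).mono_measure
        (Measure.restrict_mono (K.facet_subset_boundary i s) le_rfl)
    refine hm.ae_eq ?_
    refine ae_restrict_of_forall_mem (measurableSet_facet hΔt hK i s) ?_
    rintro _ ⟨y, hy, rfl⟩
    beta_reduce
    rw [hq y hy, chart_Φ hΔt hK (refBoundary_subset (refFace_subset i s hy))]
  -- The open facets miss only the image of the edges, a null set.
  have hset : K.boundary =ᵐ[μHE[d]] ⋃ p : Fin (d + 1) × Bool, K.facet p.1 p.2 := by
    refine Filter.EventuallyLE.antisymm ?_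
      (LE.le.eventuallyLE (iUnion_subset fun p => K.facet_subset_boundary p.1 p.2))
    rw [ae_le_set]
    refine measure_mono_null ?_ (hausdorffMeasure_image_refEdges K.contDiff_Φ)
    rintro x ⟨hx, hx'⟩
    exact (K.boundary_subset_union hx).resolve_left hx'
  rw [Measure.restrict_congr_set hset]
  have hb : ∀ p : Fin (d + 1) × Bool, ∃ C : ℝ,
      ∀ᵐ x ∂μHE[d].restrict (K.facet p.1 p.2), |μ x| ≤ C :=
    fun p => ae_abs_le_of_memLp_top (hfac p.1 p.2)
  choose C hC using hb
  refine memLp_top_of_bound (aestronglyMeasurable_iUnion_iff.2 fun p => (hfac p.1 p.2).1)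
    (∑ p, |C p|) ((ae_restrict_iUnion_iff _ _).2 fun p => ?_)
  filter_upwards [hC p] with x hx
  exact (hx.trans (le_abs_self _)).trans
    (Finset.single_le_sum (f := fun p => |C p|) (fun _ _ => abs_nonneg _) (Finset.mem_univ p))

variable (K) in
theorem carrier_ae_eq : K.carrier =ᵐ[volume] K.openCell := by
  rw [carrier_eq_union]
  exact union_ae_eq_left_of_ae_eq_empty (ae_eq_empty.2 K.volume_boundary)

variable (K) in
-- The inequality needs no case distinction: it also covers a vanishing unnormalized vector.
theorem norm_normal_le (x : X d) : ‖K.normal x‖ ≤ 1 := by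
  simp only [normal, norm_smul, norm_inv, norm_norm]
  exact inv_mul_le_one

/-- The conormal derivative is bounded by the gradient. -/
theorem dn_sq_le (f : X d → ℝ) (x : X d) : K.dn f x ^ 2 ≤ K.gradSq f x := by
  have h1 : K.dn f x ^ 2 ≤ (∑ i, K.dx f i x ^ 2) * ∑ i : Fin d, K.normal x i.succ ^ 2 :=
    Finset.sum_mul_sq_le_sq_mul_sq _ _ _
  have h2 : ∑ i : Fin d, K.normal x i.succ ^ 2 ≤ 1 := by
    have h3 := EuclideanSpace.norm_sq_eq (K.normal x)
    rw [Fin.sum_univ_succ] at h3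
    simp only [Real.norm_eq_abs, sq_abs] at h3
    have h4 := K.norm_normal_le x
    have h5 := norm_nonneg (K.normal x)
    nlinarith [sq_nonneg (K.normal x 0)]
  have h6 : 0 ≤ ∑ i, K.dx f i x ^ 2 := Finset.sum_nonneg fun _ _ => sq_nonneg _
  exact h1.trans (mul_le_of_le_one_right h6 h2)

end Element

/-! ### Elements tile the domain up to null sets. -/

namespace Mesh

variable {d : ℕ} (M : Mesh d)

/-- A closed element may leave `E`, but only along its boundary, which has zero volume. Bounds valid
almost everywhere on `E` thus pass to closed elements. -/
theorem restrict_carrier_le (k : Fin M.m) :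
    volume.restrict (M.elt k).carrier ≤ volume.restrict M.E := by
  rw [Measure.restrict_congr_set (M.elt k).carrier_ae_eq]
  exact Measure.restrict_mono (M.cell_subset k) le_rfl

theorem volume_E_lt_top : volume M.E < ⊤ := by
  refine (measure_mono subset_closure).trans_lt ?_
  rw [M.cover]
  exact (isCompact_iUnion fun k => (M.elt k).isCompact_carrier).measure_lt_top

instance isFiniteMeasure_E : IsFiniteMeasure (volume.restrict M.E) :=
  ⟨by simpa using M.volume_E_lt_top⟩

/-- `E` is squeezed between the union of the open cells and that of the closed elements, which
differ by a null set. -/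
theorem E_ae_eq : M.E =ᵐ[volume] ⋃ k, (M.elt k).openCell := by
  refine Filter.EventuallyLE.antisymm ?_
    (LE.le.eventuallyLE (iUnion_subset M.cell_subset))
  have h : M.E ⊆ ⋃ k, (M.elt k).carrier := subset_closure.trans M.cover.subset
  exact h.eventuallyLE.trans
    (Filter.EventuallyEq.countable_iUnion fun k => (M.elt k).carrier_ae_eq).le

theorem sum_setIntegral_carrier {f : X d → ℝ} (hf : IntegrableOn f M.E) :
    ∑ k, ∫ x in (M.elt k).carrier, f x = ∫ x in M.E, f x := by
  rw [setIntegral_congr_set M.E_ae_eq, integral_iUnion_fintype]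
  · exact Finset.sum_congr rfl fun k _ => setIntegral_congr_set (M.elt k).carrier_ae_eq
  · exact fun k => Element.measurableSet_openCell M.Δt_pos (M.elt_diffeo k)
  · exact fun k l hkl => M.disjoint k l hkl
  · exact fun k => hf.mono_set (M.cell_subset k)

theorem boundary_subset_closure (k : Fin M.m) : (M.elt k).boundary ⊆ closure M.E := by
  rw [M.cover]
  exact (M.elt k).boundary_subset_carrier.trans (subset_iUnion (fun k => (M.elt k).carrier) k)

end Mesh

end STHDG

/-! ### Cancellation of normal traces across interior facets. -/

namespace STHDG

theorem integral_fderiv_apply_eq_zero {d : ℕ} {ψ : X d → ℝ} (hψ : ContDiff ℝ ∞ ψ)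
    (hc : HasCompactSupport ψ) (w : X d) : ∫ x, fderiv ℝ ψ x w = 0 := by
  have hint : Integrable (fun x => fderiv ℝ ψ x w) :=
    ((hψ.continuous_fderiv (by simp)).clm_apply continuous_const).integrable_of_hasCompactSupport
      (hc.fderiv_apply ℝ w)
  have h := integral_mul_fderiv_eq_neg_fderiv_mul_of_integrable (μ := (volume : Measure (X d)))
    (f := fun _ => (1 : ℝ)) (g := ψ) (v := w) (by simp) (by simpa using hint)
    (by simpa using hψ.continuous.integrable_of_hasCompactSupport hc)
    (fun _ _ => by fun_prop) (fun _ _ => hψ.differentiable (by simp) _)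
  simpa using h

namespace Mesh

variable {d : ℕ} (M : Mesh d) {βs : X d → EuclideanSpace ℝ (Fin d)} {δ : X d → ℝ}
  {bn : Fin M.m → X d → ℝ}

/-- The union of the element boundaries. -/
def skeleton : Set (X d) := ⋃ k, (M.elt k).boundary

/-- The sum of the normal traces from all elements. -/
noncomputable def traceSum (bn : Fin M.m → X d → ℝ) (x : X d) : ℝ :=
  ∑ k, (M.elt k).boundary.indicator (bn k) x

theorem isFiniteMeasure_skeleton : IsFiniteMeasure (μHE[d].restrict M.skeleton) :=
  ⟨by
    rw [Measure.restrict_apply_univ]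
    exact (measure_iUnion_fintype_le _ _).trans_lt
      (ENNReal.sum_lt_top.2 fun k _ => (M.elt k).hausdorffMeasure_boundary_lt_top)⟩

theorem integrable_indicator_skeleton {f : X d → ℝ} {k : Fin M.m}
    (hf : IntegrableOn f (M.elt k).boundary μHE[d]) :
    Integrable ((M.elt k).boundary.indicator f) (μHE[d].restrict M.skeleton) := by
  rw [integrable_indicator_iff (M.elt k).isCompact_boundary.measurableSet]
  exact hf.mono_measure Measure.restrict_le_self

/-- Rewriting every element boundary integral against one common measure lets the sum over elements
move under the integral sign. -/
theorem setIntegral_indicator_skeleton {f : X d → ℝ} {k : Fin M.m} {s : Set (X d)}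
    (hs : MeasurableSet s) :
    ∫ x in s, (M.elt k).boundary.indicator f x ∂(μHE[d].restrict M.skeleton)
      = ∫ x in (M.elt k).boundary ∩ s, f x ∂μHE[d] := by
  have hB := (M.elt k).isCompact_boundary.measurableSet
  rw [integral_indicator hB, Measure.restrict_restrict hB, Measure.restrict_restrict
    (hB.inter hs), inter_eq_left.2]
  exact inter_subset_left.trans (subset_iUnion (fun k => (M.elt k).boundary) k)

variable {M}

theorem integral_divergence_eq_zero (hβ : MemLp βs ⊤ (volume.restrict M.E))
    (hδ : MemLp δ ⊤ (volume.restrict M.E)) (hdiv : M.IsWeakDiv βs δ) {ψ : X d → ℝ}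
    (hψ : ContDiff ℝ ∞ ψ) (hc : HasCompactSupport ψ) (hsupp : tsupport ψ ⊆ M.E) :
    IntegrableOn (fun x => fderiv ℝ ψ x (beta βs x) + δ x * ψ x) M.E ∧
    ∫ x in M.E, (fderiv ℝ ψ x (beta βs x) + δ x * ψ x) = 0 := by
  have hd : ∀ w, MemLp (fun x => fderiv ℝ ψ x w) ⊤ (volume.restrict M.E) := fun w =>
    ((hψ.continuous_fderiv (by simp)).clm_apply continuous_const).memLp_top_of_hasCompactSupport
      (hc.fderiv_apply ℝ w) _
  have hψm : MemLp ψ ⊤ (volume.restrict M.E) :=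
    hψ.continuous.memLp_top_of_hasCompactSupport hc _
  have i1 := (hd (EuclideanSpace.single 0 1)).integrable le_top
  have i2 : Integrable (fun x => ∑ i, βs x i * fderiv ℝ ψ x (EuclideanSpace.single i.succ 1))
      (volume.restrict M.E) :=
    (memLp_finsetSum _ fun i _ => MemLp.mul_top (memLp_coord hβ i) (hd _)).integrable le_top
  have i3 := (MemLp.mul_top hδ hψm).integrable le_top
  simp only [apply_beta]
  refine ⟨(i1.add i2).add i3, ?_⟩
  have e1 := integral_add (i1.add i2) i3
  simp only [Pi.add_apply] at e1
  -- The weak divergence cancels the spatial part against `δ ψ`. The time component of `β` is `1`,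
  -- so the rest is the integral of a derivative of a compactly supported function.
  rw [e1, integral_add i1 i2, hdiv ψ hψ hc hsupp,
    setIntegral_eq_integral_of_forall_compl_eq_zero, integral_fderiv_apply_eq_zero hψ hc]
  · ring
  · intro x hx
    rw [fderiv_of_notMem_tsupport (𝕜 := ℝ) (fun h => hx (hsupp h))]
    simp

/-- Green's formulas on the elements add up to a volume integral over `E`, which vanishes by the
weak divergence. -/
theorem sum_integral_trace_eq_zero (hβ : MemLp βs ⊤ (volume.restrict M.E))
    (hδ : MemLp δ ⊤ (volume.restrict M.E)) (hdiv : M.IsWeakDiv βs δ)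
    (htr : M.IsNormalTrace βs δ bn) {ψ : X d → ℝ}
    (hψ : ContDiff ℝ ∞ ψ) (hc : HasCompactSupport ψ) (hsupp : tsupport ψ ⊆ M.E) :
    ∑ k, ∫ x in (M.elt k).boundary, bn k x * ψ x ∂μHE[d] = 0 := by
  obtain ⟨hi, h0⟩ := integral_divergence_eq_zero hβ hδ hdiv hψ hc hsupp
  rw [← h0, ← M.sum_setIntegral_carrier hi]
  refine Finset.sum_congr rfl fun k _ => ?_
  have hψ1 : ContDiff ℝ 1 ψ := hψ.of_le (by simp)
  rw [← (htr k).2 ψ hψ1.contDiffOn]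
  refine setIntegral_congr_fun (M.elt k).isCompact_carrier.measurableSet fun x hx => ?_
  have hu := Element.uniqueDiffOn_carrier M.Δt_pos (M.elt_diffeo k) x hx
  rw [((hψ1.differentiable (by norm_num)) x).fderivWithin hu]

/-- The normal traces from the two sides of an interior facet cancel. -/
theorem traceSum_ae_eq_zero (hβ : MemLp βs ⊤ (volume.restrict M.E))
    (hδ : MemLp δ ⊤ (volume.restrict M.E)) (hdiv : M.IsWeakDiv βs δ)
    (htr : M.IsNormalTrace βs δ bn) :
    ∀ᵐ x ∂(μHE[d].restrict M.skeleton), x ∈ M.E → M.traceSum bn x = 0 := by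
  have := M.isFiniteMeasure_skeleton
  have hbi : ∀ k, IntegrableOn (bn k) (M.elt k).boundary μHE[d] :=
    fun k => (htr k).1.integrable le_top
  have hg : Integrable (M.traceSum bn) (μHE[d].restrict M.skeleton) :=
    integrable_finsetSum _ fun k _ => M.integrable_indicator_skeleton (hbi k)
  -- The fundamental lemma of the calculus of variations, applied to surface measure on the
  -- skeleton: testing with smooth functions supported in `E` gives the pointwise statement without
  -- pairing facets.
  refine M.E_open.ae_eq_zero_of_integral_contDiff_smul_eq_zero
    (hg.locallyIntegrable.locallyIntegrableOn _) fun ψ hψ hc hsupp => ?_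
  rw [← sum_integral_trace_eq_zero hβ hδ hdiv htr hψ hc hsupp]
  have hψb : ∀ k, IntegrableOn (fun x => bn k x * ψ x) (M.elt k).boundary μHE[d] := fun k =>
    (MemLp.mul_top (htr k).1 (hψ.continuous.memLp_top_of_hasCompactSupport hc _)).integrable le_top
  have : ∀ x, ψ x • M.traceSum bn x
      = ∑ k, (M.elt k).boundary.indicator (fun x => bn k x * ψ x) x := by
    intro x
    simp only [traceSum, smul_eq_mul, Finset.mul_sum]
    refine Finset.sum_congr rfl fun k _ => ?_
    by_cases hx : x ∈ (M.elt k).boundary <;> simp [hx, mul_comm]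
  simp_rw [this]
  rw [integral_finsetSum _ fun k _ => M.integrable_indicator_skeleton (hψb k)]
  refine Finset.sum_congr rfl fun k _ => ?_
  have := M.setIntegral_indicator_skeleton (f := fun x => bn k x * ψ x) (k := k)
    MeasurableSet.univ
  simpa using this

/-- The weight `w` is common to all elements, so it factors out of the sum of traces. -/
theorem sum_setIntegral_inter_E (hβ : MemLp βs ⊤ (volume.restrict M.E))
    (hδ : MemLp δ ⊤ (volume.restrict M.E)) (hdiv : M.IsWeakDiv βs δ)
    (htr : M.IsNormalTrace βs δ bn) {w : X d → ℝ}
    (hw : ∀ k, MemLp w ⊤ (μHE[d].restrict (M.elt k).boundary)) :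
    ∑ k, ∫ x in (M.elt k).boundary ∩ M.E, bn k x * w x ∂μHE[d] = 0 := by
  have hEm := M.E_open.measurableSet
  have hi : ∀ k, IntegrableOn (fun x => bn k x * w x) (M.elt k).boundary μHE[d] := fun k =>
    (MemLp.mul_top (htr k).1 (hw k)).integrable le_top
  have h1 : ∀ k, ∫ x in (M.elt k).boundary ∩ M.E, bn k x * w x ∂μHE[d]
      = ∫ x in M.E, (M.elt k).boundary.indicator (fun x => bn k x * w x) x
        ∂(μHE[d].restrict M.skeleton) :=
    fun k => (M.setIntegral_indicator_skeleton hEm).symm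
  simp_rw [h1]
  rw [← integral_finsetSum _ fun k _ => (M.integrable_indicator_skeleton (hi k)).integrableOn]
  refine setIntegral_eq_zero_of_ae_eq_zero ?_
  filter_upwards [traceSum_ae_eq_zero hβ hδ hdiv htr] with x hx hxE
  have : ∑ k, (M.elt k).boundary.indicator (fun x => bn k x * w x) x
      = M.traceSum bn x * w x := by
    simp only [traceSum, Finset.sum_mul]
    refine Finset.sum_congr rfl fun k _ => ?_
    by_cases hx : x ∈ (M.elt k).boundary <;> simp [hx]
  rw [this, hx hxE, zero_mul]

/-- For a single-valued function that vanishes on the Dirichlet boundary, only the contributions of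
the Neumann boundary remain in the sum of the boundary integrals. -/
theorem sum_setIntegral_boundary (hβ : MemLp βs ⊤ (volume.restrict M.E))
    (hδ : MemLp δ ⊤ (volume.restrict M.E)) (hdiv : M.IsWeakDiv βs δ)
    (htr : M.IsNormalTrace βs δ bn) {D : Set (X d)} (hDm : MeasurableSet D)
    {w : X d → ℝ}
    (hw : ∀ k, MemLp w ⊤ (μHE[d].restrict (M.elt k).boundary))
    (hw0 : ∀ᵐ x ∂(μHE[d].restrict D), w x = 0) :
    ∑ k, ∫ x in (M.elt k).boundary, bn k x * w x ∂μHE[d]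
      = ∑ k, ∫ x in (M.elt k).boundary ∩ M.neumann D, bn k x * w x ∂μHE[d] := by
  have hEm := M.E_open.measurableSet
  have hi : ∀ k, IntegrableOn (fun x => bn k x * w x) (M.elt k).boundary μHE[d] := fun k =>
    (MemLp.mul_top (htr k).1 (hw k)).integrable le_top
  -- Element boundaries lie in the closure of the open set `E`, so outside `E` they lie on its
  -- frontier.
  have hfr : ∀ k, (M.elt k).boundary \ M.E = (M.elt k).boundary ∩ frontier M.E := by
    intro k
    rw [M.E_open.frontier_eq]
    ext x
    exact ⟨fun h => ⟨h.1, M.boundary_subset_closure k h.1, h.2⟩, fun h => ⟨h.1, h.2.2⟩⟩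
  have h1 : ∀ k, ∫ x in (M.elt k).boundary, bn k x * w x ∂μHE[d]
      = ∫ x in (M.elt k).boundary ∩ M.E, bn k x * w x ∂μHE[d]
        + ∫ x in (M.elt k).boundary ∩ M.neumann D, bn k x * w x ∂μHE[d] := by
    intro k
    rw [← integral_inter_add_sdiff hEm (hi k), hfr k,
      ← integral_inter_add_sdiff (s := (M.elt k).boundary ∩ frontier M.E) hDm
        ((hi k).mono_set inter_subset_left)]
    have h0 : ∫ x in ((M.elt k).boundary ∩ frontier M.E) ∩ D, bn k x * w x ∂μHE[d] = 0 := by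
      refine integral_eq_zero_of_ae ?_
      filter_upwards [ae_restrict_of_ae_restrict_of_subset inter_subset_right hw0] with x hx
      simp [hx]
    rw [h0, zero_add, neumann, inter_sdiff_assoc]
  simp_rw [h1]
  rw [Finset.sum_add_distrib, sum_setIntegral_inter_E hβ hδ hdiv htr hw, zero_add]

end Mesh

end STHDG

/-! ### Lower bounds for the diffusive and advective forms. -/

namespace STHDG

namespace Element

variable {d : ℕ} {Δt : ℝ} {K : Element d Δt}

/-- Coercivity of the diffusive form on one element. -/
theorem diffusion_coercive (hΔt : 0 < Δt) (hK : K.IsDiffeo) {ν α cT h : ℝ} (hν : 0 < ν)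
    (hh : 0 < h) (hα : cT ^ 2 < α) {v μ : X d → ℝ}
    (hv : ContDiffOn ℝ 1 v K.carrier) (hμ : MemLp μ ⊤ (μHE[d].restrict K.boundary))
    (htrace : ∫ x in K.lateral, K.gradSq v x ∂μHE[d]
      ≤ cT ^ 2 / h * ∫ x in K.carrier, K.gradSq v x) :
    ν * ((α - cT ^ 2) / (1 + α)) * ((∫ x in K.carrier, K.gradSq v x)
        + 1 / h * ∫ x in K.lateral, (v x - μ x) ^ 2 ∂μHE[d])
      ≤ (∫ x in K.carrier, ν * ∑ i, K.dx v i x * K.dx v i x)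
        + (∫ x in K.lateral, ν * α / h * (v x - μ x) * (v x - μ x) ∂μHE[d])
        - ∫ x in K.lateral, (ν * (v x - μ x) * K.dn v x + ν * K.dn v x * (v x - μ x))
            ∂μHE[d] := by
  set c := (α - cT ^ 2) / (1 + α) with hc
  set G := ∫ x in K.carrier, K.gradSq v x with hG
  set J := ∫ x in K.lateral, (v x - μ x) ^ 2 ∂μHE[d] with hJ
  have hα0 : 0 < 1 + α := by nlinarith [sq_nonneg cT]
  have hG0 : 0 ≤ G := integral_nonneg fun x => Finset.sum_nonneg fun _ _ => sq_nonneg _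
  have e1 : (∫ x in K.carrier, ν * ∑ i, K.dx v i x * K.dx v i x) = ν * G := by
    rw [integral_const_mul]
    simp only [hG, gradSq, sq]
  have e2 : (∫ x in K.lateral, ν * α / h * (v x - μ x) * (v x - μ x) ∂μHE[d])
      = ν * α / h * J := by
    rw [hJ, ← integral_const_mul]
    simp only [sq, mul_assoc]
  -- The Young parameter leaves exactly `α - ε = c` in front of the jumps. The gradients need `cT² ≤
  -- (1 - c)(α - c)`; for this `c` the right side equals `cT² + c²`.
  set ε := α - c with hε
  have hεe : ε = (α ^ 2 + cT ^ 2) / (1 + α) := by rw [hε, hc]; field_simp; ring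
  have hα1 : 0 < α := lt_of_le_of_lt (sq_nonneg _) hα
  have hε0 : 0 < ε := by rw [hεe]; positivity
  have hεc : cT ^ 2 / ε ≤ 1 - c := by
    rw [div_le_iff₀ hε0]
    have h1c : 1 - c = (1 + cT ^ 2) / (1 + α) := by rw [hc]; field_simp; ring
    rw [h1c, hεe, div_mul_div_comm, le_div_iff₀ (by positivity)]
    nlinarith [sq_nonneg (α - cT ^ 2)]
  have hj : IntegrableOn (fun x => (v x - μ x) ^ 2) K.lateral μHE[d] :=
    IntegrableOn.mono_set ((MemLp.sq_top
      ((memLp_top_boundary hv.continuousOn).sub hμ)).integrable le_top) K.lateral_subset_boundary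
  have hg : IntegrableOn (K.gradSq v) K.lateral μHE[d] :=
    IntegrableOn.mono_set ((memLp_top_boundary
      (continuousOn_gradSq hΔt hK hv)).integrable le_top) K.lateral_subset_boundary
  have hb : ‖∫ x in K.lateral, (ν * (v x - μ x) * K.dn v x + ν * K.dn v x * (v x - μ x))
      ∂μHE[d]‖ ≤ ∫ x in K.lateral, (ν * ε / h * (v x - μ x) ^ 2 + ν * h / ε * K.gradSq v x)
        ∂μHE[d] := by
    refine norm_integral_le_of_norm_le ((hj.const_mul _).add (hg.const_mul _))
      (Filter.Eventually.of_forall fun x => ?_)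
    have h1 := dn_sq_le (K := K) v x
    -- Weighted Young inequality, by completing the square for both signs with weight `t = ε / h`.
    have h2 : |2 * ((v x - μ x) * K.dn v x)|
        ≤ ε / h * (v x - μ x) ^ 2 + h / ε * K.dn v x ^ 2 := by
      have hp : 0 < ε / h := by positivity
      have hinv : h / ε = (ε / h)⁻¹ := by rw [inv_div]
      rw [hinv]
      generalize ε / h = t at hp
      have k1 : t * (v x - μ x) ^ 2 + t⁻¹ * K.dn v x ^ 2 - 2 * ((v x - μ x) * K.dn v x)
          = t⁻¹ * (t * (v x - μ x) - K.dn v x) ^ 2 := by field_simp; ring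
      have k2 : t * (v x - μ x) ^ 2 + t⁻¹ * K.dn v x ^ 2 + 2 * ((v x - μ x) * K.dn v x)
          = t⁻¹ * (t * (v x - μ x) + K.dn v x) ^ 2 := by field_simp; ring
      have k3 : 0 ≤ t⁻¹ * (t * (v x - μ x) - K.dn v x) ^ 2 := by positivity
      have k4 : 0 ≤ t⁻¹ * (t * (v x - μ x) + K.dn v x) ^ 2 := by positivity
      rw [abs_le]
      constructor <;> linarith
    have h3 : h / ε * K.dn v x ^ 2 ≤ h / ε * K.gradSq v x :=
      mul_le_mul_of_nonneg_left h1 (by positivity)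
    have h4 : ν * (v x - μ x) * K.dn v x + ν * K.dn v x * (v x - μ x)
        = ν * (2 * ((v x - μ x) * K.dn v x)) := by ring
    rw [h4, norm_mul, Real.norm_of_nonneg hν.le, Real.norm_eq_abs]
    calc ν * |2 * ((v x - μ x) * K.dn v x)|
        ≤ ν * (ε / h * (v x - μ x) ^ 2 + h / ε * K.gradSq v x) :=
          mul_le_mul_of_nonneg_left (h2.trans (by linarith)) hν.le
      _ = ν * ε / h * (v x - μ x) ^ 2 + ν * h / ε * K.gradSq v x := by ring
  rw [integral_add (hj.const_mul _) (hg.const_mul _), integral_const_mul, integral_const_mul,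
    Real.norm_eq_abs] at hb
  have hb' := (le_abs_self _).trans hb
  -- The factor `h` cancels the `1 / h` of the trace inequality, which keeps the constant
  -- independent of `h`.
  have hb2 : ν * h / ε * (∫ x in K.lateral, K.gradSq v x ∂μHE[d]) ≤ ν * ((1 - c) * G) := by
    calc _ ≤ ν * h / ε * (cT ^ 2 / h * G) :=
          mul_le_mul_of_nonneg_left htrace (by positivity)
      _ = ν * (cT ^ 2 / ε * G) := by field_simp
      _ ≤ ν * ((1 - c) * G) := by gcongr
  rw [e1, e2]
  have hε' : ν * ε / h * J = ν * α / h * J - ν * c * (1 / h * J) := by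
    rw [hε]; ring
  rw [← hJ] at hb'
  linarith

end Element

namespace Mesh

variable {d : ℕ} {M : Mesh d} {βs : X d → EuclideanSpace ℝ (Fin d)} {δ : X d → ℝ}
  {bn : Fin M.m → X d → ℝ}

theorem IsVh.contDiffOn {pt ps : ℕ} {v : Fin M.m → X d → ℝ} (hv : M.IsVh pt ps v)
    (k : Fin M.m) : ContDiffOn ℝ 1 (v k) (M.elt k).carrier := by
  obtain ⟨q, -, hq⟩ := hv k
  exact Element.contDiffOn_of_comp_eq_eval M.Δt_pos (M.elt_diffeo k) hq

theorem IsMh.memLp {D : Set (X d)} {pt ps : ℕ} {μ : X d → ℝ} (hμ : M.IsMh D pt ps μ)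
    (k : Fin M.m) : MemLp μ ⊤ (μHE[d].restrict (M.elt k).boundary) := by
  refine Element.memLp_top_boundary_of_facets M.Δt_pos (M.elt_diffeo k) fun i s => ?_
  obtain ⟨q, -, hq⟩ := hμ.1 k i s
  exact ⟨q, hq⟩

/-- Green's formula for `v²`. -/
theorem two_mul_integral_advection (hβ : MemLp βs ⊤ (volume.restrict M.E))
    (hδ : MemLp δ ⊤ (volume.restrict M.E)) (htr : M.IsNormalTrace βs δ bn) {k : Fin M.m}
    {v : X d → ℝ} (hv : ContDiffOn ℝ 1 v (M.elt k).carrier) :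
    2 * (∫ x in (M.elt k).carrier, v x * fderivWithin ℝ v (M.elt k).carrier x (beta βs x))
      + ∫ x in (M.elt k).carrier, δ x * v x ^ 2
      = ∫ x in (M.elt k).boundary, bn k x * v x ^ 2 ∂μHE[d] := by
  have hβk := hβ.mono_measure (M.restrict_carrier_le k)
  have hδk := hδ.mono_measure (M.restrict_carrier_le k)
  have hvk : MemLp v ⊤ (volume.restrict (M.elt k).carrier) :=
    Element.memLp_top_carrier hv.continuousOn
  have hd : MemLp (fun x => fderivWithin ℝ v (M.elt k).carrier x (beta βs x)) ⊤
      (volume.restrict (M.elt k).carrier) :=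
    memLp_apply_beta (fun w => Element.memLp_top_carrier
      (Element.continuousOn_fderivWithin_apply M.Δt_pos (M.elt_diffeo k) hv w)) hβk
  -- The definition of the normal trace is tested with `v²`, which is `C¹` on the closed element.
  rw [← (htr k).2 (fun x => v x ^ 2) (hv.pow 2), ← integral_const_mul, ← integral_add
    (((MemLp.mul_top hvk hd).integrable le_top).const_mul _)
    ((MemLp.mul_top hδk (MemLp.sq_top hvk)).integrable le_top)]
  refine setIntegral_congr_fun (M.elt k).isCompact_carrier.measurableSet fun x hx => ?_
  have hu := Element.uniqueDiffOn_carrier M.Δt_pos (M.elt_diffeo k) x hx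
  have hdv := (hv.differentiableOn (by norm_num) x hx).hasFDerivWithinAt.pow 2
  have := hdv.fderivWithin hu
  beta_reduce
  rw [this]
  simp
  ring

/-- The advective form on the diagonal. -/
theorem aAdv_self (hβ : MemLp βs ⊤ (volume.restrict M.E))
    (hδ : MemLp δ ⊤ (volume.restrict M.E)) (hdiv : M.IsWeakDiv βs δ)
    (htr : M.IsNormalTrace βs δ bn) {D : Set (X d)} (hDm : MeasurableSet D)
    {v : Fin M.m → X d → ℝ} {μ : X d → ℝ}
    (hv : ∀ k, ContDiffOn ℝ 1 (v k) (M.elt k).carrier)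
    (hμ : ∀ k, MemLp μ ⊤ (μHE[d].restrict (M.elt k).boundary))
    (hμ0 : ∀ᵐ x ∂(μHE[d].restrict D), μ x = 0) :
    M.aAdv D βs bn v μ v μ = 1 / 2 * ((∑ k, ∫ x in (M.elt k).carrier, δ x * v k x ^ 2)
      + (∑ k, ∫ x in (M.elt k).boundary ∩ M.neumann D, |bn k x| * μ x ^ 2 ∂μHE[d])
      + ∑ k, ∫ x in (M.elt k).boundary, |bn k x| * (v k x - μ x) ^ 2 ∂μHE[d]) := by
  have hvb : ∀ k, MemLp (v k) ⊤ (μHE[d].restrict (M.elt k).boundary) := fun k =>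
    Element.memLp_top_boundary (hv k).continuousOn
  have ha : ∀ k, MemLp (fun x => |bn k x|) ⊤ (μHE[d].restrict (M.elt k).boundary) :=
    fun k => (htr k).1.abs
  have j1 : ∀ k, IntegrableOn (fun x => bn k x * v k x ^ 2) (M.elt k).boundary μHE[d] :=
    fun k => (MemLp.mul_top (htr k).1 (MemLp.sq_top (hvb k))).integrable le_top
  have j2 : ∀ k, IntegrableOn (fun x => bn k x * μ x ^ 2) (M.elt k).boundary μHE[d] :=
    fun k => (MemLp.mul_top (htr k).1 (MemLp.sq_top (hμ k))).integrable le_top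
  have j3 : ∀ k, IntegrableOn (fun x => |bn k x| * (v k x - μ x) ^ 2)
      (M.elt k).boundary μHE[d] :=
    fun k => (MemLp.mul_top (ha k) (MemLp.sq_top ((hvb k).sub (hμ k)))).integrable le_top
  have j4 : ∀ k, IntegrableOn (fun x => |bn k x| * μ x ^ 2) (M.elt k).boundary μHE[d] :=
    fun k => (MemLp.mul_top (ha k) (MemLp.sq_top (hμ k))).integrable le_top
  have t1 : ∀ k, ∫ x in (M.elt k).carrier,
        v k x * fderivWithin ℝ (v k) (M.elt k).carrier x (beta βs x)
      = 1 / 2 * (∫ x in (M.elt k).boundary, bn k x * v k x ^ 2 ∂μHE[d])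
        - 1 / 2 * ∫ x in (M.elt k).carrier, δ x * v k x ^ 2 := by
    intro k
    have := two_mul_integral_advection hβ hδ htr (hv k)
    linarith
  have t2 : ∀ k, ∫ x in (M.elt k).boundary ∩ M.neumann D,
        1 / 2 * (bn k x + |bn k x|) * μ x * μ x ∂μHE[d]
      = 1 / 2 * (∫ x in (M.elt k).boundary ∩ M.neumann D, bn k x * μ x ^ 2 ∂μHE[d])
        + 1 / 2 * ∫ x in (M.elt k).boundary ∩ M.neumann D, |bn k x| * μ x ^ 2 ∂μHE[d] := by
    intro k
    rw [← integral_const_mul, ← integral_const_mul, ← integral_add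
      (((j2 k).mono_set inter_subset_left).const_mul _)
      (((j4 k).mono_set inter_subset_left).const_mul _)]
    refine integral_congr_ae (Filter.Eventually.of_forall fun x => ?_)
    ring
  -- By `(v + μ)(v - μ) = v² - μ²`, the `v²` part cancels the boundary term of `t1`.
  have t3 : ∀ k, ∫ x in (M.elt k).boundary,
        1 / 2 * (bn k x * (v k x + μ x) + |bn k x| * (v k x - μ x)) * (v k x - μ x) ∂μHE[d]
      = 1 / 2 * (∫ x in (M.elt k).boundary, bn k x * v k x ^ 2 ∂μHE[d])
        + -(1 / 2) * (∫ x in (M.elt k).boundary, bn k x * μ x ^ 2 ∂μHE[d])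
        + 1 / 2 * ∫ x in (M.elt k).boundary, |bn k x| * (v k x - μ x) ^ 2 ∂μHE[d] := by
    intro k
    rw [← integral_const_mul, ← integral_const_mul, ← integral_const_mul, ← integral_add
      ((j1 k).const_mul _) ((j2 k).const_mul _)]
    have e := integral_add (((j1 k).const_mul (1 / 2)).add ((j2 k).const_mul (-(1 / 2))))
      ((j3 k).const_mul (1 / 2))
    simp only [Pi.add_apply] at e
    rw [← e]
    refine integral_congr_ae (Filter.Eventually.of_forall fun x => ?_)
    ring
  -- The remaining signed `μ²` integrals reduce to the Neumann boundary, where they cancel the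
  -- signed part of `t2`.
  have hsum := sum_setIntegral_boundary hβ hδ hdiv htr hDm (w := fun x => μ x ^ 2)
    (fun k => MemLp.sq_top (hμ k)) (by filter_upwards [hμ0] with x hx; simp [hx])
  simp only [aAdv, t1, t2, t3, Finset.sum_add_distrib, Finset.sum_sub_distrib,
    ← Finset.mul_sum]
  rw [hsum]
  ring

theorem aDiff_self_ge (hd : 0 < d) {ν α cT : ℝ} (hν : 0 < ν) (hα : cT ^ 2 < α) {pt ps : ℕ}
    (hT : M.IsTraceConst pt ps cT) {v : Fin M.m → X d → ℝ} {μ : X d → ℝ}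
    (hv : M.IsVh pt ps v)
    (hμ : ∀ k, MemLp μ ⊤ (μHE[d].restrict (M.elt k).boundary)) :
    ν * ((α - cT ^ 2) / (1 + α)) * ((∑ k, ∫ x in (M.elt k).carrier, (M.elt k).gradSq (v k) x)
        + ∑ k, 1 / (M.elt k).hK * ∫ x in (M.elt k).lateral, (v k x - μ x) ^ 2 ∂μHE[d])
      ≤ M.aDiff ν α v μ v μ := by
  rw [aDiff, ← Finset.sum_add_distrib, ← Finset.sum_add_distrib, ← Finset.sum_sub_distrib,
    Finset.mul_sum]
  exact Finset.sum_le_sum fun k _ => Element.diffusion_coercive M.Δt_pos (M.elt_diffeo k) hν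
    (Element.hK_pos hd _) hα (hv.contDiffOn k) (hμ k) (hT v hv k).2

theorem essInf_mul_le (hδ : MemLp δ ⊤ (volume.restrict M.E)) {v : Fin M.m → X d → ℝ}
    (hv : ∀ k, ContDiffOn ℝ 1 (v k) (M.elt k).carrier) :
    essInf δ (volume.restrict M.E) * ∑ k, ∫ x in (M.elt k).carrier, v k x ^ 2
      ≤ ∑ k, ∫ x in (M.elt k).carrier, δ x * v k x ^ 2 := by
  obtain ⟨C, hC⟩ := ae_abs_le_of_memLp_top hδ
  -- The real-valued `essInf` is a genuine lower bound only for a function essentially bounded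
  -- below.
  have hbd : Filter.IsBoundedUnder (· ≥ ·) (ae (volume.restrict M.E)) δ :=
    ⟨-C, by
      rw [Filter.eventually_map]
      filter_upwards [hC] with x hx using (abs_le.1 hx).1⟩
  have hle := ae_essInf_le hbd
  rw [Finset.mul_sum]
  refine Finset.sum_le_sum fun k _ => ?_
  have hvk : MemLp (fun x => v k x ^ 2) ⊤ (volume.restrict (M.elt k).carrier) :=
    MemLp.sq_top (Element.memLp_top_carrier (hv k).continuousOn)
  rw [← integral_const_mul]
  refine integral_mono_ae ((hvk.integrable le_top).const_mul _)
    ((MemLp.mul_top (hδ.mono_measure (M.restrict_carrier_le k)) hvk).integrable le_top) ?_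
  filter_upwards [(M.restrict_carrier_le k).absolutelyContinuous.ae_le hle] with x hx
  exact mul_le_mul_of_nonneg_right hx (sq_nonneg _)

end Mesh

end STHDG

/-! ### Combination of the bounds. -/

/-- Stability. The constant `c_c = min(β₀, c_α)/2` with `c_α = (α - c_T²)/(1 + α)` is fixed before the
mesh, the velocity field and the boundary partition. -/
theorem lemma4p3 (d : ℕ) (hd : 0 < d) (pt ps : ℕ) (ν α cT cp β₀ : ℝ)
    (hν : 0 < ν) (hcT : 0 < cT) (hcp : 0 < cp) (hα : cT ^ 2 < α) (hβ₀ : 0 < β₀) :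
    0 < min β₀ ((α - cT ^ 2) / (1 + α)) / 2 ∧
    ∀ (M : STHDG.Mesh d) (D : Set (STHDG.X d)),
      MeasurableSet D → D ⊆ M.lateralBoundary →
      M.IsTraceConst pt ps cT → M.IsPoincareConst D pt ps cp →
      ∀ (βs : STHDG.X d → EuclideanSpace ℝ (Fin d)) (δ : STHDG.X d → ℝ)
        (bn : Fin M.m → STHDG.X d → ℝ),
        MemLp βs ∞ (volume.restrict M.E) → MemLp δ ∞ (volume.restrict M.E) →
        M.IsWeakDiv βs δ → M.IsNormalTrace βs δ bn →
        β₀ ≤ (α - cT ^ 2) / (1 + α) * ν / cp ^ 2 + essInf δ (volume.restrict M.E) →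
        ∀ (v : Fin M.m → STHDG.X d → ℝ) (μ : STHDG.X d → ℝ),
          M.IsVh pt ps v → M.IsMh D pt ps μ →
          min β₀ ((α - cT ^ 2) / (1 + α)) / 2 * M.normSq D bn ν v μ
            ≤ M.aForm D βs bn ν α v μ v μ := by
  have hα1 : 0 < 1 + α := by nlinarith [sq_nonneg cT]
  have hc0 : 0 < (α - cT ^ 2) / (1 + α) := div_pos (by linarith) hα1
  refine ⟨half_pos (lt_min hβ₀ hc0), ?_⟩
  intro M D hDm _ hT hP βs δ bn hβ hδ hdiv htr hcond v μ hv hμ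
  -- This makes the minimum at most `1`, as required by the two terms weighted by `|bn|`, whose
  -- coefficient in the form is exactly `1/2`.
  have hc1 : (α - cT ^ 2) / (1 + α) ≤ 1 := by
    rw [div_le_one hα1]
    nlinarith [sq_nonneg cT]
  have hmβ := min_le_left β₀ ((α - cT ^ 2) / (1 + α))
  have hmc := min_le_right β₀ ((α - cT ^ 2) / (1 + α))
  have hadv := STHDG.Mesh.aAdv_self hβ hδ hdiv htr hDm hv.contDiffOn hμ.memLp hμ.2
  have hdiff := STHDG.Mesh.aDiff_self_ge hd hν hα hT hv hμ.memLp
  have hess := STHDG.Mesh.essInf_mul_le hδ hv.contDiffOn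
  have hpoin := hP v μ hv hμ
  have hJ : ∑ k, ν / (M.elt k).hK * ∫ x in (M.elt k).lateral, (v k x - μ x) ^ 2 ∂μHE[d]
      = ν * ∑ k, 1 / (M.elt k).hK
        * ∫ x in (M.elt k).lateral, (v k x - μ x) ^ 2 ∂μHE[d] := by
    rw [Finset.mul_sum]
    exact Finset.sum_congr rfl fun k _ => by ring
  have hV0 : 0 ≤ ∑ k, ∫ x in (M.elt k).carrier, v k x ^ 2 :=
    Finset.sum_nonneg fun k _ => integral_nonneg fun x => sq_nonneg _
  have hN0 : 0 ≤ ∑ k, ∫ x in (M.elt k).boundary ∩ M.neumann D,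
      |bn k x| * μ x ^ 2 ∂μHE[d] :=
    Finset.sum_nonneg fun k _ => integral_nonneg fun x => by positivity
  have hB0 : 0 ≤ ∑ k, ∫ x in (M.elt k).boundary, |bn k x| * (v k x - μ x) ^ 2 ∂μHE[d] :=
    Finset.sum_nonneg fun k _ => integral_nonneg fun x => by positivity
  have hG0 : 0 ≤ ∑ k, ∫ x in (M.elt k).carrier, (M.elt k).gradSq (v k) x :=
    Finset.sum_nonneg fun k _ => integral_nonneg fun x =>
      Finset.sum_nonneg fun _ _ => sq_nonneg _
  have hJ0 : 0 ≤ ∑ k, 1 / (M.elt k).hK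
      * ∫ x in (M.elt k).lateral, (v k x - μ x) ^ 2 ∂μHE[d] :=
    Finset.sum_nonneg fun k _ => mul_nonneg
      (one_div_nonneg.2 (STHDG.Element.hK_pos hd _).le) (integral_nonneg fun x => sq_nonneg _)
  rw [STHDG.Mesh.aForm, hadv, STHDG.Mesh.normSq, hJ, ← Finset.mul_sum]
  generalize (∑ k, ∫ x in (M.elt k).carrier, v k x ^ 2) = V at *
  generalize (∑ k, ∫ x in (M.elt k).boundary ∩ M.neumann D,
      |bn k x| * μ x ^ 2 ∂μHE[d]) = N at *
  generalize (∑ k, ∫ x in (M.elt k).boundary, |bn k x| * (v k x - μ x) ^ 2 ∂μHE[d]) = B at *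
  generalize (∑ k, ∫ x in (M.elt k).carrier, (M.elt k).gradSq (v k) x) = G at *
  generalize (∑ k, 1 / (M.elt k).hK
      * ∫ x in (M.elt k).lateral, (v k x - μ x) ^ 2 ∂μHE[d]) = J at *
  generalize (∑ k, ∫ x in (M.elt k).carrier, δ x * v k x ^ 2) = W at *
  generalize essInf δ (volume.restrict M.E) = e at *
  generalize M.aDiff ν α v μ v μ = A at *
  generalize (α - cT ^ 2) / (1 + α) = c at *
  generalize min β₀ c = m at *
  have hm1 : m ≤ 1 := hmc.trans hc1
  have hp : c * ν / cp ^ 2 * V ≤ ν * c * (G + J) := by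
    rw [div_mul_eq_mul_div, div_le_iff₀ (by positivity)]
    calc c * ν * V ≤ c * ν * (cp ^ 2 * (G + J)) :=
          mul_le_mul_of_nonneg_left hpoin (by positivity)
      _ = ν * c * (G + J) * cp ^ 2 := by ring
  have h1 : m * V ≤ c * ν / cp ^ 2 * V + e * V := by
    rw [← add_mul]
    exact mul_le_mul_of_nonneg_right (hmβ.trans hcond) hV0
  have h2 : m * N ≤ N := mul_le_of_le_one_left hN0 hm1
  have h3 : m * B ≤ B := mul_le_of_le_one_left hB0 hm1
  have h4 : m * (ν * G + ν * J) ≤ ν * c * (G + J) := by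
    calc m * (ν * G + ν * J) ≤ c * (ν * G + ν * J) :=
          mul_le_mul_of_nonneg_right hmc (by positivity)
      _ = ν * c * (G + J) := by ring
  -- Half of the diffusive bound goes through `hp` and `h1` to control `V`; the other half goes
  -- through `h4` to control `G` and `J`.
  linarith
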